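/- Let $\Lambda$ be the von Mangoldt function, i.e. $\Lambda(n)=\log p$ if $n=p^k$ for a prime $p$ and an integer $k\ge 1$, and $\Lambda(n)=0$ for all other positive integers $n$. For real $x$ put $\psi(x)=\sum_{1\le n\le x}\Lambda(n)$. Then $\psi(x)\sim x$ as $x\to\infty$ through the real numbers, that is, $\psi(x)=x+o(x)$, equivalently $\lim_{x\to\infty}\psi(x)/x=1$. -/

import Mathlib

open Filter Asymptotics

open MeasureTheory Topology

/-! This is the Wiener–Ikehara argument. Put f(u) = ψ(e^u) e^(-u), which is bounded by Chebyshev's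
estimate, and h = f - 1. For Re z > 0 the Laplace transform of h is (A(1+z) - 1)/(1+z) with A(s) =
-ζ'(s)/ζ(s) - 1/(s-1). Since ζ has no zeros on Re s = 1, this extends continuously to Re z ≥ 0.

The Fejér kernel is the Fourier transform of a compactly supported triangle. Hence the average of h
against a rescaled kernel centred at y is a Fourier integral of the boundary values of the transform
over a bounded segment, and Riemann–Lebesgue sends it to 0 as y → ∞
(`tendsto_integral_fejerKernel_mul`). Since f(u) e^u is monotone, f cannot drop quickly, so averages
at ever finer scales control f itself (`tendsto_one_of_tendsto_integral_fejerKernel`). -/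

/-! ### The Fejér kernel and its Fourier representation. -/

/-- The Fejér kernel on the real line, the Fourier transform of the triangle function. -/
noncomputable def fejerKernel (x : ℝ) : ℝ := Real.sinc (x / 2) ^ 2

theorem fejerKernel_nonneg (x : ℝ) : 0 ≤ fejerKernel x := sq_nonneg _

theorem continuous_fejerKernel : Continuous fejerKernel := by
  unfold fejerKernel
  exact (Real.continuous_sinc.comp (by fun_prop)).pow 2

theorem fejerKernel_eq {x : ℝ} (hx : x ≠ 0) : fejerKernel x = 2 * (1 - Real.cos x) / x ^ 2 := by
  have h : Real.cos x = 1 - 2 * Real.sin (x / 2) ^ 2 := by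
    have := Real.cos_sq_add_sin_sq (x / 2)
    have h2 := Real.cos_two_mul (x / 2)
    rw [mul_div_cancel₀ x two_ne_zero] at h2
    linarith
  rw [fejerKernel, Real.sinc_of_ne_zero (by positivity), h]
  field_simp
  ring

theorem fejerKernel_le (x : ℝ) : fejerKernel x ≤ 5 * (1 + x ^ 2)⁻¹ := by
  have h1 : fejerKernel x ≤ 1 := by
    rw [fejerKernel, sq_le_one_iff_abs_le_one]
    exact abs_le.2 ⟨Real.neg_one_le_sinc _, Real.sinc_le_one _⟩
  have h2 : x ^ 2 * fejerKernel x ≤ 4 := by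
    rcases eq_or_ne x 0 with rfl | hx
    · norm_num
    · rw [fejerKernel_eq hx]
      field_simp
      linarith [Real.neg_one_le_cos x]
  -- The constant 5 is the sum of the two bounds 1 and 4.
  rw [← div_eq_mul_inv, le_div_iff₀ (by positivity)]
  linarith

theorem integrable_fejerKernel : Integrable fejerKernel :=
  (integrable_inv_one_add_sq.const_mul 5).mono' continuous_fejerKernel.aestronglyMeasurable
    (Eventually.of_forall fun x => by
      rw [Real.norm_of_nonneg (fejerKernel_nonneg x)]; exact fejerKernel_le x)

theorem integral_fejerKernel_pos : 0 < ∫ x, fejerKernel x :=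
  (integral_pos_iff_support_of_nonneg fejerKernel_nonneg integrable_fejerKernel).2 <|
    continuous_fejerKernel.isOpen_support.measure_pos _ ⟨0, by simp [fejerKernel]⟩

/-- Each half of the triangle has an elementary antiderivative; it divides by ix, so x = 0 is
treated apart. -/
theorem integral_triangle_mul_exp (x : ℝ) :
    ∫ t in (-1 : ℝ)..1, ((1 - |t| : ℝ) : ℂ) * Complex.exp (t * x * Complex.I) = fejerKernel x := by
  have hc : Continuous fun t : ℝ => ((1 - |t| : ℝ) : ℂ) * Complex.exp (t * x * Complex.I) := by
    fun_prop
  rw [← intervalIntegral.integral_add_adjacent_intervals (b := 0)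
    (hc.intervalIntegrable _ _) (hc.intervalIntegrable _ _)]
  rcases eq_or_ne x 0 with rfl | hx
  · have h1 : ∫ t in (-1 : ℝ)..0, ((1 - |t| : ℝ) : ℂ) * Complex.exp (t * (0 : ℝ) * Complex.I)
        = ((∫ t in (-1 : ℝ)..0, (1 + t) : ℝ) : ℂ) := by
      rw [← intervalIntegral.integral_ofReal]
      refine intervalIntegral.integral_congr fun t ht => ?_
      rw [Set.uIcc_of_le (by norm_num)] at ht
      simp [abs_of_nonpos ht.2]
    have h2 : ∫ t in (0 : ℝ)..1, ((1 - |t| : ℝ) : ℂ) * Complex.exp (t * (0 : ℝ) * Complex.I)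
        = ((∫ t in (0 : ℝ)..1, (1 - t) : ℝ) : ℂ) := by
      rw [← intervalIntegral.integral_ofReal]
      refine intervalIntegral.integral_congr fun t ht => ?_
      rw [Set.uIcc_of_le (by norm_num)] at ht
      simp [abs_of_nonneg ht.1]
    rw [h1, h2, intervalIntegral.integral_add (by simp) (by simp),
      intervalIntegral.integral_sub (by simp) (by simp)]
    norm_num [fejerKernel]
  set c : ℂ := x * Complex.I with hcdef
  have hc0 : c ≠ 0 := by simp [hcdef, hx]
  have he (t : ℝ) : HasDerivAt (fun t : ℝ => Complex.exp (t * c)) (Complex.exp (t * c) * c) t := by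
    simpa using ((Complex.ofRealCLM.hasDerivAt (x := t)).mul_const c).cexp
  have h1 : ∫ t in (0 : ℝ)..1, ((1 - |t| : ℝ) : ℂ) * Complex.exp (t * x * Complex.I)
      = Complex.exp c / c ^ 2 - 1 / c - 1 / c ^ 2 := by
    rw [intervalIntegral.integral_eq_sub_of_hasDerivAt_of_le
      (f := fun t : ℝ => (1 - (t : ℂ)) * (Complex.exp (t * c) / c) + Complex.exp (t * c) / c ^ 2)
      zero_le_one (by fun_prop) _ (hc.intervalIntegrable _ _)]
    · simp; ring
    · intro t ht
      have := (((Complex.ofRealCLM.hasDerivAt (x := t)).const_sub 1).mul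
        ((he t).div_const c)).add ((he t).div_const (c ^ 2))
      refine this.congr_deriv ?_
      rw [abs_of_pos ht.1, mul_assoc (t : ℂ)]
      simp [← hcdef]
      field_simp
      ring
  have h2 : ∫ t in (-1 : ℝ)..0, ((1 - |t| : ℝ) : ℂ) * Complex.exp (t * x * Complex.I)
      = Complex.exp (-c) / c ^ 2 + 1 / c - 1 / c ^ 2 := by
    rw [intervalIntegral.integral_eq_sub_of_hasDerivAt_of_le
      (f := fun t : ℝ => (1 + (t : ℂ)) * (Complex.exp (t * c) / c) - Complex.exp (t * c) / c ^ 2)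
      (by norm_num) (by fun_prop) _ (hc.intervalIntegrable _ _)]
    · simp; ring
    · intro t ht
      have := (((Complex.ofRealCLM.hasDerivAt (x := t)).const_add 1).mul
        ((he t).div_const c)).sub ((he t).div_const (c ^ 2))
      refine this.congr_deriv ?_
      rw [abs_of_neg ht.2, mul_assoc (t : ℂ)]
      simp [← hcdef]
      field_simp
      ring
  rw [h1, h2, fejerKernel_eq hx]
  have h3 : c ^ 2 = -(x : ℂ) ^ 2 := by rw [hcdef, mul_pow, Complex.I_sq]; ring
  have h4 : Complex.exp c + Complex.exp (-c) = 2 * Complex.cos x := by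
    rw [Complex.two_cos, hcdef, neg_mul]
  have h5 : Complex.exp (-c) / c ^ 2 + 1 / c - 1 / c ^ 2
      + (Complex.exp c / c ^ 2 - 1 / c - 1 / c ^ 2)
      = (Complex.exp c + Complex.exp (-c) - 2) / c ^ 2 := by ring
  rw [h5, h4, h3, div_neg, ← neg_div]
  push_cast
  ring

/-! ### Fejér averages as Fourier integrals of boundary values. -/

theorem integrable_fejerKernel_comp {L : ℝ} (hL : 0 < L) (y : ℝ) :
    Integrable fun u => fejerKernel (L * (u - y)) :=
  (integrable_fejerKernel.comp_mul_left' hL.ne').comp_sub_right y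

/-- Fubini on the line Re z = d; the damping by d > 0 makes the double integral absolutely
convergent. -/
theorem integral_triangle_mul_laplace {h : ℝ → ℝ} {B : ℝ} (hm : Measurable h)
    (hB : ∀ u, |h u| ≤ B) {d : ℝ} (hd : 0 < d) (L y : ℝ) :
    ∫ t in Set.Icc (-1 : ℝ) 1, ((1 - |t| : ℝ) : ℂ) * Complex.exp (t * (L * y) * Complex.I) *
      ∫ u in Set.Ioi (0 : ℝ), (h u : ℂ) * Complex.exp (-(d + L * t * Complex.I) * u)
    = ∫ u in Set.Ioi (0 : ℝ), (h u * Real.exp (-d * u) * fejerKernel (L * (u - y)) : ℂ) := by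
  simp_rw [← integral_const_mul]
  rw [integral_integral_swap]
  · refine setIntegral_congr_fun measurableSet_Ioi fun u _ => ?_
    have hk := integral_triangle_mul_exp (-(L * (u - y)))
    have heven : fejerKernel (-(L * (u - y))) = fejerKernel (L * (u - y)) := by
      simp [fejerKernel, neg_div]
    rw [heven, intervalIntegral.integral_of_le (by norm_num), ← integral_Icc_eq_integral_Ioc] at hk
    rw [← hk, ← integral_const_mul]
    congr 1
    ext t
    have : Complex.exp (t * (L * y) * Complex.I) * Complex.exp (-(d + L * t * Complex.I) * u)
        = Complex.exp (-d * u) * Complex.exp (t * (-(L * (u - y)) : ℝ) * Complex.I) := by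
      rw [← Complex.exp_add, ← Complex.exp_add]
      congr 1
      push_cast
      ring
    push_cast at this ⊢
    linear_combination (1 - |t| : ℂ) * h u * this
  · have hi : Integrable (fun p : ℝ × ℝ => (1 : ℝ) * (B * Real.exp (-d * p.2)))
        ((volume.restrict (Set.Icc (-1 : ℝ) 1)).prod (volume.restrict (Set.Ioi 0))) :=
      (integrable_const (1 : ℝ)).mul_prod ((exp_neg_integrableOn_Ioi 0 hd).const_mul B)
    have hms : MeasurableSet (Set.Icc (-1 : ℝ) 1 ×ˢ Set.Ioi (0 : ℝ)) :=
      measurableSet_Icc.prod measurableSet_Ioi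
    refine hi.mono' ?_ ?_
    · refine Measurable.aestronglyMeasurable ?_
      unfold Function.uncurry
      fun_prop
    · rw [Measure.prod_restrict]
      refine (ae_restrict_iff' hms).2 (Eventually.of_forall ?_)
      rintro ⟨t, u⟩ ⟨ht, _⟩
      simp only [Function.uncurry, norm_mul, Complex.norm_real, Complex.norm_exp, Real.norm_eq_abs]
      have h1 : abs (1 - |t|) ≤ 1 := by
        have := abs_le.2 ht
        rw [abs_le]
        constructor <;> linarith [abs_nonneg t]
      have h2 : ((t : ℂ) * (L * y) * Complex.I).re = 0 := by simp
      have h3 : (-((d : ℂ) + L * t * Complex.I) * u).re = -d * u := by simp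
      rw [h2, h3, Real.exp_zero, mul_one]
      have := hB u
      gcongr

/-- Let d → 0+ in the damped identity. One side is dominated because G is bounded on a compact
rectangle, the other because the kernel is integrable. -/
theorem integral_triangle_mul_boundary {h : ℝ → ℝ} {B : ℝ} (hm : Measurable h)
    (hB : ∀ u, |h u| ≤ B) {G : ℂ → ℂ} (hG : ContinuousOn G {z | 0 ≤ z.re})
    (hGh : ∀ z : ℂ, 0 < z.re → G z = ∫ u in Set.Ioi (0 : ℝ), (h u : ℂ) * Complex.exp (-z * u))
    {L : ℝ} (hL : 0 < L) (y : ℝ) :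
    ∫ t in Set.Icc (-1 : ℝ) 1, ((1 - |t| : ℝ) : ℂ) * Complex.exp (t * (L * y) * Complex.I) *
      G (L * t * Complex.I)
    = ∫ u in Set.Ioi (0 : ℝ), (h u * fejerKernel (L * (u - y)) : ℂ) := by
  have hmaps (d t : ℝ) (hd : 0 ≤ d) : ((d : ℂ) + L * t * Complex.I) ∈ {z : ℂ | 0 ≤ z.re} := by
    simpa using hd
  obtain ⟨M, hM⟩ : ∃ M, ∀ d ∈ Set.Icc (0 : ℝ) 1, ∀ t ∈ Set.Icc (-1 : ℝ) 1,
      ‖G (d + L * t * Complex.I)‖ ≤ M := by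
    have hc : ContinuousOn (fun p : ℝ × ℝ => G (p.1 + L * p.2 * Complex.I))
        (Set.Icc (0 : ℝ) 1 ×ˢ Set.Icc (-1 : ℝ) 1) :=
      hG.comp (by fun_prop) fun p hp => hmaps _ _ hp.1.1
    obtain ⟨M, hM⟩ := (isCompact_Icc.prod isCompact_Icc).exists_bound_of_continuousOn hc
    exact ⟨M, fun d hd t ht => hM (d, t) ⟨hd, ht⟩⟩
  have hlim1 : Tendsto (fun d : ℝ => ∫ t in Set.Icc (-1 : ℝ) 1,
      ((1 - |t| : ℝ) : ℂ) * Complex.exp (t * (L * y) * Complex.I) * G (d + L * t * Complex.I))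
      (𝓝[>] 0) (𝓝 (∫ t in Set.Icc (-1 : ℝ) 1,
      ((1 - |t| : ℝ) : ℂ) * Complex.exp (t * (L * y) * Complex.I) * G (L * t * Complex.I))) := by
    refine tendsto_integral_filter_of_dominated_convergence (fun _ => M) ?_ ?_
      (integrable_const _) ?_
    · filter_upwards [self_mem_nhdsWithin] with d hd
      refine ContinuousOn.aestronglyMeasurable ?_ measurableSet_Icc
      refine ContinuousOn.mul (by fun_prop) (hG.comp (by fun_prop) fun t _ => hmaps d t (le_of_lt hd))
    · filter_upwards [Ioo_mem_nhdsGT (zero_lt_one (α := ℝ))] with d hd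
      refine (ae_restrict_iff' measurableSet_Icc).2 (Eventually.of_forall fun t ht => ?_)
      have h1 : abs (1 - |t|) ≤ 1 := by
        have := abs_le.2 ht
        rw [abs_le]
        constructor <;> linarith [abs_nonneg t]
      have h2 : ((t : ℂ) * (L * y) * Complex.I).re = 0 := by simp
      rw [norm_mul, norm_mul, Complex.norm_real, Complex.norm_exp, Real.norm_eq_abs, h2,
        Real.exp_zero, mul_one]
      have h3 := hM d ⟨hd.1.le, hd.2.le⟩ t ht
      calc _ ≤ 1 * ‖G (d + L * t * Complex.I)‖ := by gcongr
        _ ≤ M := by rwa [one_mul]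
    · refine Eventually.of_forall fun t => ?_
      refine Tendsto.const_mul _ ?_
      have h0 := hG _ (hmaps 0 t le_rfl)
      have : Tendsto (fun d : ℝ => (d : ℂ) + L * t * Complex.I) (𝓝[>] 0)
          (𝓝[{z | 0 ≤ z.re}] (((0 : ℝ) : ℂ) + L * t * Complex.I)) := by
        refine tendsto_nhdsWithin_iff.2 ⟨?_, ?_⟩
        · exact ((by fun_prop : Continuous fun d : ℝ => (d : ℂ) + L * t * Complex.I).tendsto
            0).mono_left nhdsWithin_le_nhds
        · filter_upwards [self_mem_nhdsWithin] with d hd using hmaps d t (le_of_lt hd)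
      simpa [Function.comp_def] using h0.tendsto.comp this
  have hlim2 : Tendsto (fun d : ℝ => ∫ u in Set.Ioi (0 : ℝ),
      (h u * Real.exp (-d * u) * fejerKernel (L * (u - y)) : ℂ))
      (𝓝[>] 0) (𝓝 (∫ u in Set.Ioi (0 : ℝ), (h u * fejerKernel (L * (u - y)) : ℂ))) := by
    have hmk : Measurable fejerKernel := continuous_fejerKernel.measurable
    refine tendsto_integral_filter_of_dominated_convergence
      (fun u => B * fejerKernel (L * (u - y))) ?_ ?_
      ((integrable_fejerKernel_comp hL y).const_mul B).integrableOn ?_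
    · exact Eventually.of_forall fun d => Measurable.aestronglyMeasurable (by fun_prop)
    · filter_upwards [self_mem_nhdsWithin] with d hd
      refine (ae_restrict_iff' measurableSet_Ioi).2 (Eventually.of_forall fun u hu => ?_)
      have h1 : Real.exp (-d * u) ≤ 1 := by
        rw [Real.exp_le_one_iff, neg_mul, neg_nonpos]
        exact mul_nonneg (le_of_lt hd) (le_of_lt hu)
      rw [norm_mul, norm_mul, Complex.norm_real, Complex.norm_real, Complex.norm_real,
        Real.norm_eq_abs, Real.norm_of_nonneg (Real.exp_nonneg _),
        Real.norm_of_nonneg (fejerKernel_nonneg _)]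
      have := hB u
      have hk := fejerKernel_nonneg (L * (u - y))
      have hB0 : 0 ≤ B := (abs_nonneg _).trans this
      calc _ ≤ B * 1 * fejerKernel (L * (u - y)) := by gcongr
        _ = _ := by ring
    · refine Eventually.of_forall fun u => ?_
      have : Tendsto (fun d : ℝ => (h u * Real.exp (-d * u) * fejerKernel (L * (u - y)) : ℂ))
          (𝓝[>] 0) (𝓝 (h u * Real.exp (-0 * u) * fejerKernel (L * (u - y)) : ℂ)) :=
        ((by fun_prop : Continuous fun d : ℝ =>
          (h u * Real.exp (-d * u) * fejerKernel (L * (u - y)) : ℂ)).tendsto' 0 _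
            (by simp)).mono_left nhdsWithin_le_nhds
      simpa using this
  refine tendsto_nhds_unique hlim1 (hlim2.congr' ?_)
  filter_upwards [self_mem_nhdsWithin] with d hd
  rw [← integral_triangle_mul_laplace hm hB hd L y]
  refine setIntegral_congr_fun measurableSet_Icc fun t _ => ?_
  rw [hGh]
  simpa using hd

theorem tendsto_integral_fejerKernel_mul {h : ℝ → ℝ} {B : ℝ} (hm : Measurable h)
    (hB : ∀ u, |h u| ≤ B) {G : ℂ → ℂ} (hG : ContinuousOn G {z | 0 ≤ z.re})
    (hGh : ∀ z : ℂ, 0 < z.re → G z = ∫ u in Set.Ioi (0 : ℝ), (h u : ℂ) * Complex.exp (-z * u))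
    {L : ℝ} (hL : 0 < L) :
    Tendsto (fun y => ∫ u in Set.Ioi (0 : ℝ), h u * fejerKernel (L * (u - y))) atTop (𝓝 0) := by
  have hRL := Real.tendsto_integral_exp_smul_cocompact
    ((Set.Icc (-1 : ℝ) 1).indicator fun t : ℝ => ((1 - |t| : ℝ) : ℂ) * G (L * t * Complex.I))
  -- The Fourier character is e^(2πix), so the phase tLy corresponds to the frequency -Ly/(2π).
  have hw : Tendsto (fun y : ℝ => -(L / (2 * Real.pi)) * y) atTop (cocompact ℝ) :=
    (tendsto_id.const_mul_atTop_of_neg (neg_neg_of_pos (by positivity))).mono_right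
      atBot_le_cocompact
  have := hRL.comp hw
  have h2 : Tendsto (fun y => ((∫ u in Set.Ioi (0 : ℝ), h u * fejerKernel (L * (u - y)) : ℝ) : ℂ))
      atTop (𝓝 0) := by
    refine this.congr fun y => ?_
    rw [← integral_complex_ofReal]
    push_cast
    rw [← integral_triangle_mul_boundary hm hB hG hGh hL y, ← integral_indicator measurableSet_Icc]
    simp only [Function.comp]
    congr 1
    ext t
    by_cases ht : t ∈ Set.Icc (-1 : ℝ) 1
    · rw [Set.indicator_of_mem ht, Set.indicator_of_mem ht, Circle.smul_def, Real.fourierChar_apply,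
        smul_eq_mul]
      have : ((2 * Real.pi * -(t * (-(L / (2 * Real.pi)) * y)) : ℝ) : ℂ) * Complex.I
          = t * (L * y) * Complex.I := by
        have := Real.pi_ne_zero
        rw [show 2 * Real.pi * -(t * (-(L / (2 * Real.pi)) * y)) = t * (L * y) by field_simp]
        push_cast
        ring
      rw [this]
      push_cast
      ring
    · rw [Set.indicator_of_notMem ht, Set.indicator_of_notMem ht, smul_zero]
  simpa using! (Complex.continuous_re.tendsto 0).comp h2

/-! ### The Tauberian step: from averages back to the function. -/

theorem integral_mul_fejerKernel_comp (g : ℝ → ℝ) {L : ℝ} (hL : 0 < L) (y : ℝ) :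
    ∫ w, g (y + w / L) * fejerKernel w = L * ∫ u, g u * fejerKernel (L * (u - y)) := by
  have h1 := integral_sub_right_eq_self (μ := volume)
    (fun u => g (y + L * u / L) * fejerKernel (L * u)) y
  have h2 := Measure.integral_comp_mul_left (fun w => g (y + w / L) * fejerKernel w) L
  rw [abs_of_pos (inv_pos.2 hL), smul_eq_mul] at h2
  have h3 (u : ℝ) : y + L * (u - y) / L = u := by field_simp; ring
  simp_rw [h3] at h1
  rw [h1, h2, mul_inv_cancel_left₀ hL.ne']

theorem integrable_bounded_mul_fejerKernel {g : ℝ → ℝ} {C : ℝ} (hm : Measurable g)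
    (hC : ∀ u, |g u| ≤ C) {L : ℝ} (y : ℝ) :
    Integrable fun w => g (y + w / L) * fejerKernel w := by
  refine integrable_fejerKernel.bdd_mul (c := C) ?_ ?_
  · exact (by fun_prop : Measurable fun w => g (y + w / L)).aestronglyMeasurable
  · exact Eventually.of_forall fun w => hC _

/-- On the whole line the subtracted 1 becomes the indicator of (0, ∞), whose averages tend to the
full mass of the kernel. -/
theorem tendsto_integral_comp_mul_fejerKernel {f : ℝ → ℝ} {C : ℝ} (hm : Measurable f)
    (h0 : ∀ u, 0 ≤ f u) (hC : ∀ u, f u ≤ C) (hneg : ∀ u ≤ 0, f u = 0) {L : ℝ} (hL : 0 < L)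
    (hlim : Tendsto (fun y => ∫ u in Set.Ioi (0 : ℝ), (f u - 1) * fejerKernel (L * (u - y)))
      atTop (𝓝 0)) :
    Tendsto (fun y => ∫ w, f (y + w / L) * fejerKernel w) atTop (𝓝 (∫ w, fejerKernel w)) := by
  set i : ℝ → ℝ := (Set.Ioi (0 : ℝ)).indicator fun _ => 1 with hi
  have him : Measurable i := measurable_const.indicator measurableSet_Ioi
  have hib (u : ℝ) : |i u| ≤ 1 := by
    by_cases hu : u ∈ Set.Ioi (0 : ℝ) <;> simp [hi, hu]
  have hfb (u : ℝ) : |f u| ≤ C := by rw [abs_of_nonneg (h0 u)]; exact hC u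
  have h1 : Tendsto (fun y => ∫ w, i (y + w / L) * fejerKernel w) atTop
      (𝓝 (∫ w, fejerKernel w)) := by
    refine tendsto_integral_filter_of_dominated_convergence fejerKernel ?_ ?_
      integrable_fejerKernel ?_
    · exact Eventually.of_forall fun y =>
        (integrable_bounded_mul_fejerKernel him hib y).aestronglyMeasurable
    · refine Eventually.of_forall fun y => Eventually.of_forall fun w => ?_
      rw [norm_mul, Real.norm_of_nonneg (fejerKernel_nonneg w)]
      exact mul_le_of_le_one_left (fejerKernel_nonneg w) (hib _)
    · refine Eventually.of_forall fun w => tendsto_const_nhds.congr' ?_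
      filter_upwards [eventually_gt_atTop (-(w / L))] with y hy
      have : y + w / L ∈ Set.Ioi (0 : ℝ) := by simp only [Set.mem_Ioi]; linarith
      simp [hi, Set.indicator_of_mem this]
  have h2 := (hlim.const_mul L).add h1
  rw [mul_zero, zero_add] at h2
  refine h2.congr fun y => ?_
  have h3 : ∫ u in Set.Ioi (0 : ℝ), (f u - 1) * fejerKernel (L * (u - y))
      = ∫ u, (f u - i u) * fejerKernel (L * (u - y)) := by
    rw [← integral_indicator measurableSet_Ioi]
    congr 1
    ext u
    by_cases hu : u ∈ Set.Ioi (0 : ℝ)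
    · simp [hi, Set.indicator_of_mem hu]
    · simp [hi, Set.indicator_of_notMem hu, hneg u (not_lt.1 hu)]
  rw [h3, ← integral_mul_fejerKernel_comp (fun u => f u - i u) hL y, ← integral_add]
  · congr 1
    ext w
    ring
  · simp_rw [sub_mul]
    exact (integrable_bounded_mul_fejerKernel hm hfb y).sub
      (integrable_bounded_mul_fejerKernel him hib y)
  · exact integrable_bounded_mul_fejerKernel him hib y

/-- The scale R/η turns |w| ≤ R into a window of radius η. Centred at y + η it lies in [y, y + 2η],
where monotonicity gives at least e^(-2η) f(y); the tails are nonnegative and dropped. -/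
theorem integral_fejerKernel_window_mul_le {f : ℝ → ℝ} {C : ℝ} (hm : Measurable f)
    (h0 : ∀ u, 0 ≤ f u) (hC : ∀ u, f u ≤ C) (hmono : Monotone fun u => f u * Real.exp u)
    {η R : ℝ} (hη : 0 < η) (hR : 0 < R) (y : ℝ) :
    Real.exp (-(2 * η)) * f y * ∫ w in Set.Icc (-R) R, fejerKernel w
      ≤ ∫ w, f (y + η + w / (R / η)) * fejerKernel w := by
  have hfb (u : ℝ) : |f u| ≤ C := by rw [abs_of_nonneg (h0 u)]; exact hC u
  have hint := integrable_bounded_mul_fejerKernel (L := R / η) hm hfb (y + η)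
  refine le_trans ?_ (setIntegral_le_integral (s := Set.Icc (-R) R) hint
    (Eventually.of_forall fun w => mul_nonneg (h0 _) (fejerKernel_nonneg w)))
  rw [← integral_const_mul]
  refine setIntegral_mono_on (integrable_fejerKernel.integrableOn.const_mul _)
    hint.integrableOn measurableSet_Icc fun w hw => ?_
  refine mul_le_mul_of_nonneg_right ?_ (fejerKernel_nonneg w)
  set v := w / (R / η) with hv
  have hvl : -η ≤ v := by
    rw [hv, le_div_iff₀ (by positivity)]
    field_simp
    linarith [hw.1]
  have hvu : v ≤ η := by
    rw [hv, div_le_iff₀ (by positivity)]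
    field_simp
    linarith [hw.2]
  have h1 : f y * Real.exp y ≤ f (y + η + v) * Real.exp (y + η + v) := hmono (by linarith)
  have h2 : f y ≤ f (y + η + v) * Real.exp (η + v) := by
    rw [add_assoc y, Real.exp_add, mul_comm (Real.exp y), ← mul_assoc] at h1
    rw [← add_assoc] at h1
    exact le_of_mul_le_mul_right h1 (Real.exp_pos y)
  have h3 : f y ≤ f (y + η + v) * Real.exp (2 * η) :=
    h2.trans (mul_le_mul_of_nonneg_left (Real.exp_le_exp.2 (by linarith)) (h0 _))
  rw [Real.exp_neg, inv_mul_le_iff₀ (Real.exp_pos _)]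
  linarith

/-- Mirror image: the window is [y - 2η, y], and the tails cost at most C times the missing mass. -/
theorem integral_comp_mul_fejerKernel_le {f : ℝ → ℝ} {C : ℝ} (hm : Measurable f)
    (h0 : ∀ u, 0 ≤ f u) (hC : ∀ u, f u ≤ C) (hmono : Monotone fun u => f u * Real.exp u)
    {η R : ℝ} (hη : 0 < η) (hR : 0 < R) (y : ℝ) :
    ∫ w, f (y - η + w / (R / η)) * fejerKernel w
      ≤ Real.exp (2 * η) * f y * (∫ w in Set.Icc (-R) R, fejerKernel w)
        + C * ((∫ w, fejerKernel w) - ∫ w in Set.Icc (-R) R, fejerKernel w) := by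
  have hfb (u : ℝ) : |f u| ≤ C := by rw [abs_of_nonneg (h0 u)]; exact hC u
  have hint := integrable_bounded_mul_fejerKernel (L := R / η) hm hfb (y - η)
  rw [← integral_add_compl measurableSet_Icc hint (s := Set.Icc (-R) R),
    ← integral_add_compl measurableSet_Icc integrable_fejerKernel (s := Set.Icc (-R) R),
    add_sub_cancel_left, ← integral_const_mul, ← integral_const_mul]
  refine add_le_add ?_ ?_
  · refine setIntegral_mono_on hint.integrableOn
      (integrable_fejerKernel.integrableOn.const_mul _) measurableSet_Icc fun w hw => ?_
    refine mul_le_mul_of_nonneg_right ?_ (fejerKernel_nonneg w)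
    set v := w / (R / η) with hv
    have hvl : -η ≤ v := by
      rw [hv, le_div_iff₀ (by positivity)]
      field_simp
      linarith [hw.1]
    have hvu : v ≤ η := by
      rw [hv, div_le_iff₀ (by positivity)]
      field_simp
      linarith [hw.2]
    have h1 : f (y - η + v) * Real.exp (y - η + v) ≤ f y * Real.exp y := hmono (by linarith)
    have h2 : f (y - η + v) ≤ f y * Real.exp (η - v) := by
      rw [show y = (η - v) + (y - η + v) by ring, Real.exp_add (η - v), ← mul_assoc] at h1
      rw [show η - v + (y - η + v) = y by ring] at h1
      exact le_of_mul_le_mul_right h1 (Real.exp_pos _)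
    refine h2.trans ?_
    rw [mul_comm]
    exact mul_le_mul_of_nonneg_right (Real.exp_le_exp.2 (by linarith)) (h0 _)
  · refine setIntegral_mono_on hint.integrableOn
      (integrable_fejerKernel.integrableOn.const_mul _) measurableSet_Icc.compl fun w _ => ?_
    exact mul_le_mul_of_nonneg_right (hC _) (fejerKernel_nonneg w)

theorem tendsto_integral_Icc_fejerKernel :
    Tendsto (fun R => ∫ w in Set.Icc (-R) R, fejerKernel w) atTop (𝓝 (∫ w, fejerKernel w)) := by
  have := intervalIntegral_tendsto_integral integrable_fejerKernel tendsto_neg_atTop_atBot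
    tendsto_id
  refine this.congr' ?_
  filter_upwards [eventually_ge_atTop 0] with R hR
  rw [id, intervalIntegral.integral_of_le (by linarith), integral_Icc_eq_integral_Ioc]

/-- A bounded function `f` on the line with `f u * exp u` monotone tends to `1` at infinity if its
averages against all rescaled Fejér kernels do. -/
theorem tendsto_one_of_tendsto_integral_fejerKernel {f : ℝ → ℝ} {C : ℝ} (hm : Measurable f)
    (h0 : ∀ u, 0 ≤ f u) (hC : ∀ u, f u ≤ C) (hneg : ∀ u ≤ 0, f u = 0)
    (hmono : Monotone fun u => f u * Real.exp u)
    (hlim : ∀ L : ℝ, 0 < L → Tendsto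
      (fun y => ∫ u in Set.Ioi (0 : ℝ), (f u - 1) * fejerKernel (L * (u - y))) atTop (𝓝 0)) :
    Tendsto f atTop (𝓝 1) := by
  set c := ∫ w, fejerKernel w with hc
  have hcpos : 0 < c := integral_fejerKernel_pos
  set k : ℝ → ℝ := fun R => ∫ w in Set.Icc (-R) R, fejerKernel w with hk
  have hkc : Tendsto (fun η : ℝ => k η⁻¹) (𝓝[>] 0) (𝓝 c) :=
    tendsto_integral_Icc_fejerKernel.comp tendsto_inv_nhdsGT_zero
  have hη : Tendsto (fun η : ℝ => η) (𝓝[>] 0) (𝓝 0) := nhdsWithin_le_nhds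
  have hexp : Tendsto (fun η : ℝ => Real.exp (2 * η)) (𝓝[>] 0) (𝓝 1) :=
    ((by fun_prop : Continuous fun η : ℝ => Real.exp (2 * η)).tendsto' 0 1 (by simp)).mono_left
      nhdsWithin_le_nhds
  have hup : Tendsto (fun η => (c + η) * Real.exp (2 * η) / k η⁻¹) (𝓝[>] 0) (𝓝 1) := by
    have := ((hη.const_add c).mul hexp).div hkc hcpos.ne'
    rwa [add_zero, mul_one, div_self hcpos.ne'] at this
  have hlo : Tendsto (fun η => (c - η - C * (c - k η⁻¹)) / (Real.exp (2 * η) * k η⁻¹))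
      (𝓝[>] 0) (𝓝 1) := by
    have := ((hη.const_sub c).sub ((hkc.const_sub c).const_mul C)).div (hexp.mul hkc)
      (by rw [one_mul]; exact hcpos.ne')
    rwa [sub_self, mul_zero, sub_zero, sub_zero, one_mul, div_self hcpos.ne'] at this
  -- Taking R = 1/η lets the window shrink while the kernel mass inside it fills up, with one
  -- parameter η → 0.
  have havg (η : ℝ) (hη : 0 < η) := tendsto_integral_comp_mul_fejerKernel hm h0 hC hneg
    (L := η⁻¹ / η) (by positivity) (hlim _ (by positivity))
  refine tendsto_order.2 ⟨fun a ha => ?_, fun a ha => ?_⟩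
  · obtain ⟨η, ⟨h1, h2⟩, hη0⟩ := ((hlo.eventually_const_lt ha).and
      (hkc.eventually_const_lt hcpos) |>.and self_mem_nhdsWithin).exists
    have hη0 : 0 < η := hη0
    have h3 := ((havg η hη0).comp (tendsto_atTop_add_const_right atTop (-η) tendsto_id))
      |>.eventually_const_lt (sub_lt_self c hη0)
    filter_upwards [h3] with y hy
    have h4 := integral_comp_mul_fejerKernel_le hm h0 hC hmono hη0 (inv_pos.2 hη0) y
    simp only [Function.comp, id, ← sub_eq_add_neg] at hy
    refine h1.trans ?_
    rw [div_lt_iff₀ (by positivity)]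
    linarith
  · obtain ⟨η, ⟨h1, h2⟩, hη0⟩ := ((hup.eventually_lt_const ha).and
      (hkc.eventually_const_lt hcpos) |>.and self_mem_nhdsWithin).exists
    have hη0 : 0 < η := hη0
    have h3 := ((havg η hη0).comp (tendsto_atTop_add_const_right atTop η tendsto_id))
      |>.eventually_lt_const (lt_add_of_pos_right c hη0)
    filter_upwards [h3] with y hy
    have h4 := integral_fejerKernel_window_mul_le hm h0 hC hmono hη0 (inv_pos.2 hη0) y
    simp only [Function.comp, id] at hy
    refine lt_of_le_of_lt ?_ h1
    rw [le_div_iff₀ h2]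
    have h5 := h4.trans hy.le
    rw [Real.exp_neg, mul_assoc, inv_mul_le_iff₀ (Real.exp_pos _)] at h5
    linarith

/-! ### The Laplace transform of ψ(e^u) e^(-u) - 1 and the conclusion. -/

open ArithmeticFunction in
-- Partial summation, justified by Chebyshev's bound ψ(n) = O(n).
theorem LSeries_vonMangoldt_eq_mul_integral_psi {s : ℂ} (hs : 1 < s.re) :
    LSeries (fun n => (vonMangoldt n : ℂ)) s
      = s * ∫ t in Set.Ioi (1 : ℝ), (Chebyshev.psi t : ℂ) * (t : ℂ) ^ (-(s + 1)) := by
  have hpsi (n : ℕ) : ∑ k ∈ Finset.Icc 1 n, vonMangoldt k = Chebyshev.psi n := by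
    rw [Chebyshev.psi, Nat.floor_natCast]
    rfl
  rw [LSeries_eq_mul_integral_of_nonneg (fun n => vonMangoldt n) zero_le_one hs ?_
    fun n => vonMangoldt_nonneg]
  · congr 2
    ext t
    rw [Chebyshev.psi_eq_psi_coe_floor t, ← hpsi]
    push_cast
    rfl
  · simp_rw [hpsi, Real.rpow_one]
    refine IsBigO.of_bound (Real.log 4 + 4) (Eventually.of_forall fun n => ?_)
    rw [Real.norm_of_nonneg (Chebyshev.psi_nonneg _), Real.norm_of_nonneg (Nat.cast_nonneg n)]
    exact Chebyshev.psi_le_const_mul_self (Nat.cast_nonneg n)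

theorem integral_psi_exp_mul_exp (z : ℂ) :
    ∫ u in Set.Ioi (0 : ℝ), ((Chebyshev.psi (Real.exp u) * Real.exp (-u) : ℝ) : ℂ)
      * Complex.exp (-z * u)
    = ∫ t in Set.Ioi (1 : ℝ), (Chebyshev.psi t : ℂ) * (t : ℂ) ^ (-((1 + z) + 1)) := by
  rw [← Real.exp_zero, ← integral_comp_exp_Ioi]
  refine setIntegral_congr_fun measurableSet_Ioi fun u _ => ?_
  have h1 : ((Real.exp u : ℝ) : ℂ) ^ (-((1 + z) + 1)) = Complex.exp (u * (-((1 + z) + 1))) := by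
    rw [Complex.ofReal_exp, Complex.cpow_def_of_ne_zero (Complex.exp_ne_zero _),
      ← Complex.ofReal_exp, ← Complex.ofReal_log (Real.exp_pos u).le, Real.log_exp]
  have h2 : Complex.exp (-(u : ℂ)) * Complex.exp (-z * u)
      = Complex.exp u * Complex.exp (u * (-((1 + z) + 1))) := by
    rw [← Complex.exp_add, ← Complex.exp_add]
    congr 1
    ring
  simp only [Complex.real_smul]
  rw [h1]
  push_cast
  linear_combination (Chebyshev.psi (Real.exp u) : ℂ) * h2

theorem psi_exp_mul_exp_neg_le (u : ℝ) :
    Chebyshev.psi (Real.exp u) * Real.exp (-u) ≤ Real.log 4 + 4 := by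
  rw [Real.exp_neg, ← div_eq_mul_inv, div_le_iff₀ (Real.exp_pos u)]
  exact Chebyshev.psi_le_const_mul_self (Real.exp_pos u).le

theorem psi_exp_mul_exp_neg_nonneg (u : ℝ) : 0 ≤ Chebyshev.psi (Real.exp u) * Real.exp (-u) :=
  mul_nonneg (Chebyshev.psi_nonneg _) (Real.exp_pos _).le

theorem measurable_psi_exp_mul_exp_neg :
    Measurable fun u => Chebyshev.psi (Real.exp u) * Real.exp (-u) :=
  (Chebyshev.psi_mono.measurable.comp Real.measurable_exp).mul (by fun_prop)

open ArithmeticFunction.vonMangoldt in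
theorem integral_psi_exp_sub_one_mul_exp {z : ℂ} (hz : 0 < z.re) :
    (LFunctionResidueClassAux (1 : ZMod 1) (1 + z) - 1) / (1 + z)
      = ∫ u in Set.Ioi (0 : ℝ), ((Chebyshev.psi (Real.exp u) * Real.exp (-u) - 1 : ℝ) : ℂ)
        * Complex.exp (-z * u) := by
  have hs : 1 < (1 + z).re := by simpa using hz
  have hz0 : z ≠ 0 := fun h => by simp [h] at hz
  have hs0 : 1 + z ≠ 0 := fun h => by rw [h] at hs; norm_num at hs
  have hexp : IntegrableOn (fun u : ℝ => Complex.exp (-z * u)) (Set.Ioi 0) :=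
    integrableOn_exp_mul_complex_Ioi (by simpa using hz) 0
  -- Modulo 1 the residue class is everything, so the auxiliary function is the full series minus
  -- its pole.
  have hA : LFunctionResidueClassAux (1 : ZMod 1) (1 + z)
      = LSeries (fun n => (ArithmeticFunction.vonMangoldt n : ℂ)) (1 + z) - 1 / z := by
    rw [eqOn_LFunctionResidueClassAux isUnit_one hs]
    have (n : ℕ) : residueClass (1 : ZMod 1) n = ArithmeticFunction.vonMangoldt n :=
      Set.indicator_of_mem (s := {n : ℕ | (n : ZMod 1) = 1})
        (Subsingleton.elim (n : ZMod 1) 1) _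
    simp [this]
  have hint : IntegrableOn (fun u : ℝ => ((Chebyshev.psi (Real.exp u) * Real.exp (-u) : ℝ) : ℂ)
      * Complex.exp (-z * u)) (Set.Ioi 0) := by
    refine hexp.bdd_mul (c := Real.log 4 + 4) ?_ (Eventually.of_forall fun u => ?_)
    · exact (Complex.measurable_ofReal.comp measurable_psi_exp_mul_exp_neg).aestronglyMeasurable
    · rw [Complex.norm_real, Real.norm_of_nonneg (psi_exp_mul_exp_neg_nonneg u)]
      exact psi_exp_mul_exp_neg_le u
  have hsplit : ∫ u in Set.Ioi (0 : ℝ), ((Chebyshev.psi (Real.exp u) * Real.exp (-u) - 1 : ℝ) : ℂ)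
        * Complex.exp (-z * u)
      = (∫ u in Set.Ioi (0 : ℝ), ((Chebyshev.psi (Real.exp u) * Real.exp (-u) : ℝ) : ℂ)
        * Complex.exp (-z * u)) - ∫ u in Set.Ioi (0 : ℝ), Complex.exp (-z * u) := by
    rw [← integral_sub hint hexp]
    congr 1
    ext u
    push_cast
    ring
  rw [hsplit, integral_psi_exp_mul_exp, integral_exp_mul_complex_Ioi (by simpa using hz), hA,
    LSeries_vonMangoldt_eq_mul_integral_psi hs]
  simp
  field_simp
  ring

open ArithmeticFunction.vonMangoldt in
theorem tendsto_psi_exp_mul_exp_neg :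
    Tendsto (fun u => Chebyshev.psi (Real.exp u) * Real.exp (-u)) atTop (𝓝 1) := by
  refine tendsto_one_of_tendsto_integral_fejerKernel measurable_psi_exp_mul_exp_neg
    psi_exp_mul_exp_neg_nonneg psi_exp_mul_exp_neg_le (fun u hu => ?_) ?_ fun L hL => ?_
  · rw [Chebyshev.psi_eq_zero_of_le_one (Real.exp_le_one_iff.2 hu), zero_mul]
  · intro u v huv
    simp only [mul_assoc, ← Real.exp_add, neg_add_cancel, Real.exp_zero, mul_one]
    exact Chebyshev.psi_mono (Real.exp_le_exp.2 huv)
  · refine tendsto_integral_fejerKernel_mul (B := Real.log 4 + 4 + 1)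
      (measurable_psi_exp_mul_exp_neg.sub_const 1) (fun u => ?_)
      (G := fun z => (LFunctionResidueClassAux (1 : ZMod 1) (1 + z) - 1) / (1 + z)) ?_
      (fun z hz => integral_psi_exp_sub_one_mul_exp hz) hL
    · have h1 := psi_exp_mul_exp_neg_le u
      have h2 := psi_exp_mul_exp_neg_nonneg u
      rw [abs_le]
      constructor <;> linarith
    · refine ContinuousOn.div (ContinuousOn.sub ?_ continuousOn_const) (by fun_prop) fun z hz h => ?_
      -- The non-vanishing of ζ on Re s = 1 enters here, through continuity up to the boundary.
      · refine (continuousOn_LFunctionResidueClassAux (1 : ZMod 1)).comp (by fun_prop) fun z hz => ?_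
        simpa using hz
      · have h1 := congrArg Complex.re h
        simp only [Complex.add_re, Complex.one_re, Complex.zero_re, Set.mem_ofPred_eq] at h1 hz
        linarith

theorem mainTheorem3 :
    (fun x : ℝ => Chebyshev.psi x) ~[atTop] (fun x : ℝ => x) := by
  refine isEquivalent_of_tendsto_one ?_
  refine (tendsto_psi_exp_mul_exp_neg.comp Real.tendsto_log_atTop).congr' ?_
  filter_upwards [eventually_gt_atTop 0] with x hx
  simp [Real.exp_neg, Real.exp_log hx, div_eq_mul_inv]
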